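/- **Setting.** Agents $i\in\mathcal I=\{1,\dots,N\}$ control $x[t+1]=Ax[t]+\sum_i B_iu_i[t]$, $x[t]\in\mathbb R^n$, $u_i[t]\in\mathbb R^m$; $\phi[t\,|\,x_0,\boldsymbol u]$ denotes the state at time $t$. Write $\boldsymbol u_{-i}=(u_j)_{j\ne i}$ and $\|x\|_M^2=x^\top Mx$. The constraints are $x[t]\in\mathbb X$ and $u_i[t]\in\mathbb U_i(\boldsymbol u_{-i}[t])$, and the stage costs are $\ell_i(x,u_i)=\tfrac12\|x\|_{Q_i}^2+\tfrac12\|u_i\|_{R_i}^2$. For $T\in\mathbb N\cup\{\infty\}$ let $\mathcal U_{i,T}(x_0,\boldsymbol u_{-i})$ be the set of $T$-long sequences $u_i$ with $u_i[t]\in\mathbb U_i(\boldsymbol u_{-i}[t])$ for $0\le t<T$ and $\phi[t|x_0,\boldsymbol u]\in\mathbb X$ for $1\le t\le T$ (for all $t\ge1$ if $T=\infty$). Let $J_i^\infty(v_i|x_0,\boldsymbol u_{-i})=\sum_{t\ge0}\ell_i(\phi[t|x_0,v_i,\boldsymbol u_{-i}],v_i[t])\in[0,\infty]$. For $x_0\in\mathbb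 X$, $\boldsymbol u$ is an *infinite-horizon constrained open-loop Nash equilibrium trajectory* (OL-NE) at $x_0$ if for all $i$, $u_i\in\mathcal U_{i,\infty}(x_0,\boldsymbol u_{-i})$ and $J_i^\infty(u_i|x_0,\boldsymbol u_{-i})\le\inf_{v_i\in\mathcal U_{i,\infty}(x_0,\boldsymbol u_{-i})}J_i^\infty(v_i|x_0,\boldsymbol u_{-i})$. **Assumptions.** 1. $0\in\mathrm{int}\,\mathbb X$, and for all $i$: $0\in\mathrm{int}\,\mathbb U_i(0)$, $Q_i=C_i^\top C_i$, $R_i=R_i^\top\succ0$. 2. $A$ is invertible; for all $i$, $(A,B_i)$ is stabilizable and $(A,C_i)$ is detectable. 3. With $S_j=B_jR_j^{-1}B_j^\top$, the matrix $$H=\begin{bmatrix}A+\sum_jS_jA^{-\top}Q_j & \mathrm{row}(-S_jA^{-\top})_j\\ \mathrm{col}(-A^{-\top}Q_j)_j & I_N\otimes A^{-\top}\end{bmatrix}$$ has exactly $n$ eigenvalues of modulus $<1$ (with multiplicity), and an $n$-dimensional stable invariant subspace of $H$ is complementary to $\mathrm{Im}\begin{bmatrix}0_{n\times Nn}\\ I_{Nn}\end{bmatrix}$.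 Let $(P_i,K_i)_{i}$ be a stabilizing solution of the coupled Riccati equations: for all $i$, $$P_i=Q_i+A^\top P_i\bar A,\qquad K_i=-R_i^{-1}B_i^\top P_i\bar A,\qquad \bar A:=A+\sum_jB_jK_j,$$ with all eigenvalues of $\bar A$ of modulus $<1$. For each $i$ put $$\widehat A_i=\begin{bmatrix}A&\sum_{j\ne i}B_jK_j\\0&\bar A\end{bmatrix},\quad \widehat B_i=\begin{bmatrix}B_i\\0\end{bmatrix},\quad \widehat Q_i=\begin{bmatrix}Q_i&0\\0&0\end{bmatrix},$$ let $\widehat P_i\succeq0$ solve $\widehat P_i=\widehat Q_i+\widehat A_i^\top\widehat P_i(\widehat A_i+\widehat B_i\widehat K_i)$, $\widehat K_i=-(R_i+\widehat B_i^\top\widehat P_i\widehat B_i)^{-1}\widehat B_i^\top\widehat P_i\widehat A_i$, and let $V_i(x,y)=\tfrac12\|\mathrm{col}(x,y)\|^2_{\widehat P_i}$. Let $\mathbb X_f$ be a constraint-admissible forward invariant set for $x[t+1]=\bar Ax[t]$: $\mathbb X_f\subseteq\mathbb X$, and for all $x\in\mathbb X_f$, $\bar Ax\in\mathbb X_f$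 and $K_ix\in\mathbb U_i((K_jx)_{j\ne i})$ for all $i$. For finite $T$, say that $\boldsymbol u^{FH}$ *solves the finite-horizon game* at $x_0$ if for all $i$ $$u_i^{FH}\in\operatorname*{argmin}_{u_i\in\mathcal U_{i,T}(x_0,\boldsymbol u^{FH}_{-i})}\ \sum_{t=0}^{T-1}\ell_i(\phi[t|x_0,u_i,\boldsymbol u_{-i}^{FH}],u_i[t])+V_i\big(\phi[T|x_0,u_i,\boldsymbol u_{-i}^{FH}],\phi[T|x_0,\boldsymbol u^{FH}]\big).$$ Let $\mathcal X$ be the set of $x_0\in\mathbb X$ at which the game has a solution with terminal state in $\mathbb X_f$. **Theorem.** Let $x_0\in\mathcal X$, let $\boldsymbol u^{FH}$ solve the finite-horizon game at $x_0$, let $x^{FH}[T]=\phi[T|x_0,\boldsymbol u^{FH}]$, and suppose $x^{FH}[T]\in\mathbb X_f$. Define $$u_i^{EX}[t]=\begin{cases}u_i^{FH}[t]&t<T,\\ K_i\bar A^{\,t-T}x^{FH}[T]&t\ge T.\end{cases}$$ Then $\boldsymbol u^{EX}$ is an infinite-horizon constrained open-loop Nash equilibrium trajectory at $x_0$. -/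

import Mathlib

open scoped Matrix Kronecker

noncomputable section

/-- A real square matrix is Schur if all its (complex) eigenvalues have modulus less than one. -/
def IsSchur {ι : Type} [Fintype ι] [DecidableEq ι] (M : Matrix ι ι ℝ) : Prop :=
  ∀ z ∈ spectrum ℂ (M.map (fun r : ℝ => (r : ℂ))), ‖z‖ < 1

/-- `(A, B)` is stabilizable: some state feedback makes `A + B F` Schur. -/
def IsStabilizable {n m : ℕ} (A : Matrix (Fin n) (Fin n) ℝ) (B : Matrix (Fin n) (Fin m) ℝ) :
    Prop :=
  ∃ F : Matrix (Fin m) (Fin n) ℝ, IsSchur (A + B * F)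

/-- `(A, C)` is detectable: some output injection makes `A + L C` Schur. -/
def IsDetectable {n p : ℕ} (A : Matrix (Fin n) (Fin n) ℝ) (C : Matrix (Fin p) (Fin n) ℝ) :
    Prop :=
  ∃ L : Matrix (Fin n) (Fin p) ℝ, IsSchur (A + L * C)

/-- The weighted square norm `‖x‖²_M = xᵀ M x`. -/
def wsq {ι : Type} [Fintype ι] (M : Matrix ι ι ℝ) (x : ι → ℝ) : ℝ :=
  x ⬝ᵥ (M *ᵥ x)

/-- The data of a constrained linear-quadratic dynamic game with `N` agents, state dimension `n`,
input dimension `m` (for each agent): dynamics `x[t+1] = A x[t] + ∑ i, B i u_i[t]`, weights `Q i`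
and `R i`, a factor `C i` of `Q i` with `p i` rows, the set `X` of admissible states, and the maps
`U i` from the inputs of the agents other than `i` to the set of admissible inputs of `i`. -/
structure LQGame (N n m : ℕ) where
  A : Matrix (Fin n) (Fin n) ℝ
  B : Fin N → Matrix (Fin n) (Fin m) ℝ
  Q : Fin N → Matrix (Fin n) (Fin n) ℝ
  R : Fin N → Matrix (Fin m) (Fin m) ℝ
  p : Fin N → ℕ
  C : (i : Fin N) → Matrix (Fin (p i)) (Fin n) ℝ
  X : Set (Fin n → ℝ)
  U : (i : Fin N) → ({j : Fin N // j ≠ i} → (Fin m → ℝ)) → Set (Fin m → ℝ)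

namespace LQGame

variable {N n m : ℕ} (G : LQGame N n m)

/-- The state sequence `φ[t | x₀, u]`. -/
def state (x₀ : Fin n → ℝ) (u : Fin N → ℕ → (Fin m → ℝ)) : ℕ → (Fin n → ℝ)
  | 0 => x₀
  | t + 1 => G.A *ᵥ (state x₀ u t) + ∑ i, G.B i *ᵥ u i t

/-- The stage cost `ℓ_i(x, u_i)`. -/
def stageCost (i : Fin N) (x : Fin n → ℝ) (v : Fin m → ℝ) : ℝ :=
  (1 / 2) * wsq (G.Q i) x + (1 / 2) * wsq (G.R i) v

/-- `v` is an admissible input sequence of agent `i` over the horizon `T` (possibly infinite),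
given the input sequences `u_j`, `j ≠ i`, of the others. The entry `u i` is not used. -/
def IsFeasibleFor (T : ℕ∞) (x₀ : Fin n → ℝ) (i : Fin N) (u : Fin N → ℕ → (Fin m → ℝ))
    (v : ℕ → (Fin m → ℝ)) : Prop :=
  (∀ t : ℕ, (t : ℕ∞) < T → v t ∈ G.U i (fun j => u j t)) ∧
  (∀ t : ℕ, 1 ≤ t → (t : ℕ∞) ≤ T → G.state x₀ (Function.update u i v) t ∈ G.X)

/-- The infinite-horizon admissible input sequences of agent `i`. -/
def feasibleInf (x₀ : Fin n → ℝ) (i : Fin N) (u : Fin N → ℕ → (Fin m → ℝ)) :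
    Set (ℕ → (Fin m → ℝ)) :=
  {v | G.IsFeasibleFor ⊤ x₀ i u v}

/-- A `T`-long sequence, continued by zero (the continuation is never used before time `T`). -/
def pad {T : ℕ} (v : Fin T → (Fin m → ℝ)) : ℕ → (Fin m → ℝ) :=
  fun t => if h : t < T then v ⟨t, h⟩ else 0

/-- The `T`-long admissible input sequences of agent `i`. -/
def feasibleFin {T : ℕ} (x₀ : Fin n → ℝ) (i : Fin N) (u : Fin N → Fin T → (Fin m → ℝ)) :
    Set (Fin T → (Fin m → ℝ)) :=
  {v | G.IsFeasibleFor (T : ℕ∞) x₀ i (fun j => pad (u j)) (pad v)}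

/-- The infinite-horizon cost of agent `i` when it plays `v` and the others play `u_j`, `j ≠ i`.
It is a series of nonnegative terms (`Q i` and `R i` are positive semidefinite), with values in
`[0, ∞]`. -/
def costInf (x₀ : Fin n → ℝ) (i : Fin N) (u : Fin N → ℕ → (Fin m → ℝ))
    (v : ℕ → (Fin m → ℝ)) : ENNReal :=
  ∑' t : ℕ, ENNReal.ofReal (G.stageCost i (G.state x₀ (Function.update u i v) t) (v t))

/-- Infinite-horizon constrained open-loop Nash trajectory at `x₀`. -/
def IsOpenLoopNash (x₀ : Fin n → ℝ) (u : Fin N → ℕ → (Fin m → ℝ)) : Prop :=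
  (∀ i, u i ∈ G.feasibleInf x₀ i u) ∧
  ∀ i, G.costInf x₀ i u (u i) ≤ ⨅ v ∈ G.feasibleInf x₀ i u, G.costInf x₀ i u v

/-- The origin is strictly feasible, `Q i = (C i)ᵀ C i`, and `R i` is symmetric positive
definite. -/
structure BasicAssumption : Prop where
  zero_mem_X : (0 : Fin n → ℝ) ∈ interior G.X
  zero_mem_U : ∀ i, (0 : Fin m → ℝ) ∈ interior (G.U i 0)
  Q_eq : ∀ i, G.Q i = (G.C i)ᵀ * G.C i
  R_posDef : ∀ i, (G.R i).PosDef

/-- `A` is invertible, each `(A, B i)` is stabilizable and each `(A, C i)` is detectable. -/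
structure PrimitivesAssumption : Prop where
  A_inv : IsUnit G.A
  stabilizable : ∀ i, IsStabilizable G.A (G.B i)
  detectable : ∀ i, IsDetectable G.A (G.C i)

/-- `S i = B i (R i)⁻¹ (B i)ᵀ`. -/
def S (i : Fin N) : Matrix (Fin n) (Fin n) ℝ := G.B i * (G.R i)⁻¹ * (G.B i)ᵀ

/-- The matrix `H`, of size `n + N n`. -/
def H : Matrix (Fin n ⊕ Fin N × Fin n) (Fin n ⊕ Fin N × Fin n) ℝ :=
  Matrix.fromBlocks
    (G.A + ∑ j, G.S j * (G.A⁻¹)ᵀ * G.Q j)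
    (Matrix.of fun r jc => (-(G.S jc.1 * (G.A⁻¹)ᵀ)) r jc.2)
    (Matrix.of fun jr c => (-((G.A⁻¹)ᵀ * G.Q jr.1)) jr.2 c)
    ((1 : Matrix (Fin N) (Fin N) ℝ) ⊗ₖ (G.A⁻¹)ᵀ)

/-- `H` has exactly `n` eigenvalues (with algebraic multiplicity) of modulus less than one, and
an `n`-dimensional `H`-invariant subspace on which all eigenvalues have modulus less than one is
complementary to the range of `col(0, I)`. -/
structure StructureAssumption : Prop where
  card_stable : ((G.H.map (fun r : ℝ => (r : ℂ))).charpoly.roots.countP (fun z => ‖z‖ < 1)) = n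
  complementary : ∃ (W : Submodule ℝ (Fin n ⊕ Fin N × Fin n → ℝ))
    (hW : ∀ w ∈ W, Matrix.toLin' G.H w ∈ W),
    Module.finrank ℝ W = n ∧
    (∀ z ∈ ((((Matrix.toLin' G.H).restrict hW).charpoly).map (algebraMap ℝ ℂ)).roots, ‖z‖ < 1) ∧
    IsCompl W (LinearMap.range (Matrix.toLin'
      (Matrix.fromRows (0 : Matrix (Fin n) (Fin N × Fin n) ℝ)
        (1 : Matrix (Fin N × Fin n) (Fin N × Fin n) ℝ))))

/-- The closed-loop matrix `A + ∑ j, B j (K j)`. -/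
def Abar (K : Fin N → Matrix (Fin m) (Fin n) ℝ) : Matrix (Fin n) (Fin n) ℝ :=
  G.A + ∑ j, G.B j * K j

/-- The coupled open-loop Riccati equations for `(P i, K i)`. -/
def SolvesOLRiccati (P : Fin N → Matrix (Fin n) (Fin n) ℝ)
    (K : Fin N → Matrix (Fin m) (Fin n) ℝ) : Prop :=
  ∀ i, P i = G.Q i + G.Aᵀ * P i * G.Abar K ∧
    K i = -((G.R i)⁻¹ * (G.B i)ᵀ * P i * G.Abar K)

/-- The unconstrained open-loop input sequence `u_i^OL[t | x] = K i (Abar ^ t) x`. -/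
def uOL (K : Fin N → Matrix (Fin m) (Fin n) ℝ) (x : Fin n → ℝ) (i : Fin N) (t : ℕ) :
    Fin m → ℝ :=
  K i *ᵥ ((G.Abar K ^ t) *ᵥ x)

/-- Augmented dynamics matrix. -/
def Ahat (K : Fin N → Matrix (Fin m) (Fin n) ℝ) (i : Fin N) :
    Matrix (Fin n ⊕ Fin n) (Fin n ⊕ Fin n) ℝ :=
  Matrix.fromBlocks G.A (∑ j ∈ Finset.univ.erase i, G.B j * K j) 0 (G.Abar K)

/-- Augmented input matrix `col(B i, 0)`. -/
def Bhat (i : Fin N) : Matrix (Fin n ⊕ Fin n) (Fin m) ℝ :=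
  Matrix.fromRows (G.B i) 0

/-- Augmented state weight. -/
def Qhat (i : Fin N) : Matrix (Fin n ⊕ Fin n) (Fin n ⊕ Fin n) ℝ :=
  Matrix.fromBlocks (G.Q i) 0 0 0

/-- Feedback gain `-(R + Bhatᵀ Phat Bhat)⁻¹ Bhatᵀ Phat Ahat` attached to a matrix `Phat`. -/
def Khat (K : Fin N → Matrix (Fin m) (Fin n) ℝ) (i : Fin N)
    (Phat : Matrix (Fin n ⊕ Fin n) (Fin n ⊕ Fin n) ℝ) : Matrix (Fin m) (Fin n ⊕ Fin n) ℝ :=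
  -((G.R i + (G.Bhat i)ᵀ * Phat * G.Bhat i)⁻¹ * (G.Bhat i)ᵀ * Phat * G.Ahat K i)

/-- `Phat` is a positive semidefinite solution of the algebraic Riccati equation of the augmented
system of agent `i`. -/
def SolvesAugmentedARE (K : Fin N → Matrix (Fin m) (Fin n) ℝ) (i : Fin N)
    (Phat : Matrix (Fin n ⊕ Fin n) (Fin n ⊕ Fin n) ℝ) : Prop :=
  Phat.PosSemidef ∧
  Phat = G.Qhat i + (G.Ahat K i)ᵀ * Phat * (G.Ahat K i + G.Bhat i * G.Khat K i Phat)

/-- The augmented-space cost-to-go `V(x, y) = ½ ‖col(x, y)‖²` weighted by `Phat`. -/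
def V (Phat : Matrix (Fin n ⊕ Fin n) (Fin n ⊕ Fin n) ℝ) (x y : Fin n → ℝ) : ℝ :=
  (1 / 2) * wsq Phat (Sum.elim x y)

/-- The finite-horizon cost of agent `i` playing `v`, parametrized by the input sequences `u` of
all the agents: the second argument of the terminal cost depends on `u i` too. -/
def costFin {T : ℕ} (Phat : Fin N → Matrix (Fin n ⊕ Fin n) (Fin n ⊕ Fin n) ℝ)
    (x₀ : Fin n → ℝ) (i : Fin N) (u : Fin N → Fin T → (Fin m → ℝ))
    (v : Fin T → (Fin m → ℝ)) : ℝ :=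
  ∑ t : Fin T,
      G.stageCost i (G.state x₀ (fun j => pad (Function.update u i v j)) (t : ℕ)) (v t) +
    V (Phat i) (G.state x₀ (fun j => pad (Function.update u i v j)) T)
      (G.state x₀ (fun j => pad (u j)) T)

/-- `u` solves the finite-horizon game at `x₀`: each `u i` minimizes the finite-horizon cost of
agent `i`, parametrized by `u`, over the admissible `T`-long input sequences. -/
def SolvesFiniteHorizon {T : ℕ} (Phat : Fin N → Matrix (Fin n ⊕ Fin n) (Fin n ⊕ Fin n) ℝ)
    (x₀ : Fin n → ℝ) (u : Fin N → Fin T → (Fin m → ℝ)) : Prop :=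
  ∀ i, u i ∈ G.feasibleFin x₀ i u ∧
    IsMinOn (G.costFin Phat x₀ i u) (G.feasibleFin x₀ i u) (u i)

/-- `Xf` is a constraint-admissible forward invariant set of `x[t+1] = Abar x[t]`, where the
inputs that generate these dynamics are `u_i = K i x`. -/
structure IsAdmissibleInvariant (K : Fin N → Matrix (Fin m) (Fin n) ℝ)
    (Xf : Set (Fin n → ℝ)) : Prop where
  subset : Xf ⊆ G.X
  input_mem : ∀ x ∈ Xf, ∀ i, K i *ᵥ x ∈ G.U i (fun j => K j *ᵥ x)
  invariant : ∀ x ∈ Xf, G.Abar K *ᵥ x ∈ Xf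

/-- The set of admissible initial states from which some solution of the finite-horizon game has
its terminal state in `Xf`. -/
def initialSet (T : ℕ) (Phat : Fin N → Matrix (Fin n ⊕ Fin n) (Fin n ⊕ Fin n) ℝ)
    (Xf : Set (Fin n → ℝ)) : Set (Fin n → ℝ) :=
  {x₀ | x₀ ∈ G.X ∧ ∃ u : Fin N → Fin T → (Fin m → ℝ),
    G.SolvesFiniteHorizon Phat x₀ u ∧ G.state x₀ (fun j => pad (u j)) T ∈ Xf}

/-- The extended input sequence: `uFH` before time `T`, and from `T` on the unconstrained
open-loop sequence started at the terminal state of `uFH`. -/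
def uEX {T : ℕ} (K : Fin N → Matrix (Fin m) (Fin n) ℝ) (x₀ : Fin n → ℝ)
    (uFH : Fin N → Fin T → (Fin m → ℝ)) : Fin N → ℕ → (Fin m → ℝ) :=
  fun i t => if h : t < T then uFH i ⟨t, h⟩
    else G.uOL K (G.state x₀ (fun j => pad (uFH j)) T) i (t - T)

end LQGame

end

/-! After time `T` the other agents play `K j *ᵥ y`, where `y` is the orbit of `Abar` from the
nominal terminal state. Being open loop, these inputs do not react to a deviation of agent `i`, so
the tail problem of `i` is a linear-quadratic problem for the augmented state `(x, y)`, with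
cost-to-go `V`.

Two facts about tails give the theorem. Any tail of finite cost costs at least `V`
(`V_le_tsum_stageCost`): the Riccati equation makes `V` decrease by at most the stage cost, and
detectability forces `x → 0`, so that `V → 0`. The tail of `uEX` costs at most `V`
(`sum_stageCost_uOL_le_V`): the coupled Riccati equations are the stationarity conditions, with
costate `P i *ᵥ y`, of a convex problem, hence this tail does no worse than the response generated
by `Khat`, which costs at most `V`.

For an admissible deviation `v` this yields the chain: infinite cost of `v` ≥ finite cost of its
first `T` entries ≥ finite cost of `uFH` ≥ infinite cost of `uEX`. The tail bound ignores
constraints, so only the constraints up to time `T` matter for `v`. -/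

open Filter Topology

/-! ### Stable linear recursions. -/

section Schur

attribute [local instance] Matrix.linftyOpNormedAddCommGroup Matrix.linftyOpNormedRing
  Matrix.linftyOpNormedAlgebra Matrix.linftyOpNormedSpace

theorem Matrix.linfty_opNorm_map_ofReal {ι : Type} [Fintype ι] (M : Matrix ι ι ℝ) :
    ‖M.map (fun r : ℝ => (r : ℂ))‖ = ‖M‖ := by
  simp [Matrix.linfty_opNorm_def]

/-- The powers of a Schur matrix are absolutely summable. -/
theorem IsSchur.summable_norm_pow {ι : Type} [Fintype ι] [DecidableEq ι] {M : Matrix ι ι ℝ}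
    (hM : IsSchur M) : Summable fun k : ℕ => ‖M ^ k‖ := by
  rcases isEmpty_or_nonempty ι with hι | hι
  · exact summable_zero.congr fun k => by rw [Subsingleton.elim (M ^ k) 0, norm_zero]
  set a : Matrix ι ι ℂ := M.map (fun r : ℝ => (r : ℂ)) with ha
  have hpow (k : ℕ) : ‖M ^ k‖ = ‖a ^ k‖ := by
    rw [← Matrix.linfty_opNorm_map_ofReal]
    congr 1
    exact map_pow (Complex.ofRealHom.mapMatrix) M k
  simp_rw [hpow]
  have hr : spectralRadius ℂ a < (1 : NNReal) :=
    spectrum.spectralRadius_lt_of_forall_lt a fun z hz => hM z hz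
  -- By Gelfand's formula `‖a ^ k‖ ≤ r ^ k` eventually, for any `r` strictly between the spectral
  -- radius and 1.
  obtain ⟨r, hr1, hr2⟩ := ENNReal.lt_iff_exists_nnreal_btwn.1 hr
  have hr2' : r < 1 := by exact_mod_cast hr2
  have hlim := spectrum.pow_nnnorm_pow_one_div_tendsto_nhds_spectralRadius a
  refine (NNReal.summable_coe.2 (NNReal.summable_geometric hr2')).of_norm_bounded_eventually_nat ?_
  filter_upwards [hlim.eventually (gt_mem_nhds hr1), eventually_gt_atTop 0] with k hk hk0
  rw [norm_norm, ← coe_nnnorm, NNReal.coe_le_coe, ← ENNReal.coe_le_coe]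
  have hk' : (k : ℝ) ≠ 0 := by positivity
  have h := ENNReal.rpow_le_rpow hk.le (Nat.cast_nonneg k)
  rw [← ENNReal.rpow_mul, one_div_mul_cancel hk', ENNReal.rpow_one, ENNReal.rpow_natCast] at h
  exact_mod_cast h

/-- A Schur linear system driven by a vanishing disturbance converges to the origin. -/
theorem IsSchur.tendsto_zero {ι : Type} [Fintype ι] [DecidableEq ι] {M : Matrix ι ι ℝ}
    (hM : IsSchur M) {x w : ℕ → ι → ℝ} (hx : ∀ t, x (t + 1) = M *ᵥ x t + w t)
    (hw : Tendsto w atTop (𝓝 0)) : Tendsto x atTop (𝓝 0) := by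
  have hsum := hM.summable_norm_pow
  obtain ⟨c, hc⟩ := hw.norm.bddAbove_range
  have hc' (t : ℕ) : ‖w t‖ ≤ c := hc ⟨t, rfl⟩
  -- Variation of constants; the truncated subtraction is exact because `s < t` in the sum.
  have hx' (t : ℕ) : x t = M ^ t *ᵥ x 0 + ∑ s ∈ Finset.range t, M ^ s *ᵥ w (t - 1 - s) := by
    induction t with
    | zero => simp
    | succ t ih =>
      rw [hx, ih, Finset.sum_range_succ', Matrix.mulVec_add, Matrix.mulVec_mulVec, ← pow_succ',
        Matrix.mulVec_sum, add_assoc]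
      simp only [pow_zero, Matrix.one_mulVec, Matrix.mulVec_mulVec, ← pow_succ']
      have hs (s : ℕ) : t - 1 - s = t - (s + 1) := by omega
      simp only [hs, Nat.add_sub_cancel, Nat.sub_zero]
  have h1 : Tendsto (fun t : ℕ => M ^ t *ᵥ x 0) atTop (𝓝 0) :=
    squeeze_zero_norm (fun t => Matrix.linfty_opNorm_mulVec _ _)
      (by simpa using hsum.tendsto_atTop_zero.mul_const ‖x 0‖)
  have h2 : Tendsto (fun t => ∑ s ∈ Finset.range t, M ^ s *ᵥ w (t - 1 - s)) atTop (𝓝 0) := by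
    -- Extension by zero turns the convolution into a series over all `s`: each term vanishes as `t
    -- → ∞`, and `‖M ^ s‖ * c` dominates.
    let f : ℕ → ℕ → ι → ℝ := fun t s => if s < t then M ^ s *ᵥ w (t - 1 - s) else 0
    have hf (t : ℕ) : ∑ s ∈ Finset.range t, M ^ s *ᵥ w (t - 1 - s) = ∑' s, f t s := by
      rw [tsum_eq_sum (s := Finset.range t) fun s hs => if_neg (by simpa using hs)]
      exact Finset.sum_congr rfl fun s hs => (if_pos (Finset.mem_range.1 hs)).symm
    simp_rw [hf]
    rw [← tsum_zero (β := ℕ)]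
    refine tendsto_tsum_of_dominated_convergence (hsum.mul_right c) (fun s => ?_)
      (Eventually.of_forall fun t s => ?_)
    · have : Tendsto (fun t : ℕ => ‖M ^ s‖ * ‖w (t - 1 - s)‖) atTop (𝓝 0) := by
        simpa [Nat.sub_sub] using (hw.norm.comp (tendsto_sub_atTop_nat (1 + s))).const_mul ‖M ^ s‖
      refine squeeze_zero_norm (fun t => ?_) this
      by_cases h : s < t
      · simpa [f, h] using Matrix.linfty_opNorm_mulVec _ _
      · simp only [f, h, if_false, norm_zero]; positivity
    · by_cases h : s < t
      · simp only [f, h, if_true]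
        exact (Matrix.linfty_opNorm_mulVec _ _).trans
          (mul_le_mul_of_nonneg_left (hc' _) (norm_nonneg _))
      · simp only [f, h, if_false, norm_zero]
        exact mul_nonneg (norm_nonneg _) ((norm_nonneg _).trans (hc' 0))
  have h := h1.add h2
  rw [add_zero] at h
  exact h.congr fun t => (hx' t).symm

end Schur

/-! ### Quadratic forms. -/

theorem tendsto_zero_of_dotProduct_self {ι α : Type} [Fintype ι] {l : Filter α} {x : α → ι → ℝ}
    (h : Tendsto (fun t => x t ⬝ᵥ x t) l (𝓝 0)) : Tendsto x l (𝓝 0) := by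
  rw [tendsto_pi_nhds]
  intro i
  refine squeeze_zero_norm (a := fun t => √(x t ⬝ᵥ x t)) (fun t => ?_) (by simpa using h.sqrt)
  rw [Real.norm_eq_abs]
  refine Real.abs_le_sqrt ?_
  rw [sq]
  exact Finset.single_le_sum (f := fun j => x t j * x t j) (fun j _ => mul_self_nonneg _)
    (Finset.mem_univ i)

theorem Matrix.dotProduct_transpose_mulVec_eq {ι κ : Type} [Fintype ι] [Fintype κ]
    (M : Matrix ι κ ℝ) (a : κ → ℝ) (b : ι → ℝ) : a ⬝ᵥ (Mᵀ *ᵥ b) = (M *ᵥ a) ⬝ᵥ b := by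
  rw [Matrix.mulVec_transpose, dotProduct_comm, ← Matrix.dotProduct_mulVec, dotProduct_comm]

theorem wsq_transpose_mul_self {ι κ : Type} [Fintype ι] [Fintype κ] (M : Matrix κ ι ℝ)
    (x : ι → ℝ) : wsq (Mᵀ * M) x = (M *ᵥ x) ⬝ᵥ (M *ᵥ x) := by
  rw [wsq, ← Matrix.mulVec_mulVec, Matrix.dotProduct_transpose_mulVec_eq]

theorem Matrix.PosSemidef.wsq_nonneg {ι : Type} [Fintype ι] {M : Matrix ι ι ℝ} (hM : M.PosSemidef)
    (x : ι → ℝ) : 0 ≤ wsq M x := by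
  simpa [wsq] using hM.dotProduct_mulVec_nonneg x

/-- Writing `M = Bᵀ * B` with `B` invertible, the hypothesis says that `B *ᵥ x t` tends to zero;
then apply `B⁻¹`. -/
theorem Matrix.PosDef.tendsto_zero_of_wsq {ι α : Type} [Fintype ι] [DecidableEq ι]
    {l : Filter α} {M : Matrix ι ι ℝ} (hM : M.PosDef) {x : α → ι → ℝ}
    (h : Tendsto (fun t => wsq M (x t)) l (𝓝 0)) : Tendsto x l (𝓝 0) := by
  open scoped MatrixOrder in
  obtain ⟨B, hB⟩ := CStarAlgebra.nonneg_iff_eq_star_mul_self.mp hM.posSemidef.nonneg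
  rw [Matrix.star_eq_conjTranspose, Matrix.conjTranspose_eq_transpose_of_trivial] at hB
  have hunit : IsUnit (Bᵀ * B).det := hB ▸ (Matrix.isUnit_iff_isUnit_det _).1 hM.isUnit
  have hBu : IsUnit B.det := by
    rw [Matrix.det_mul] at hunit
    exact isUnit_of_mul_isUnit_right hunit
  subst hB
  simp_rw [wsq_transpose_mul_self] at h
  have hBx := tendsto_zero_of_dotProduct_self h
  have hcont : Continuous fun y : ι → ℝ => B⁻¹ *ᵥ y := by fun_prop
  have := (hcont.tendsto 0).comp hBx
  simpa [Function.comp_def, Matrix.mulVec_mulVec, Matrix.nonsing_inv_mul B hBu] using this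

/-- Completion of squares along a solution of the algebraic Riccati equation. -/
theorem wsq_completeSquare {ι κ : Type} [Fintype ι] [Fintype κ] {A P Q : Matrix ι ι ℝ}
    {B : Matrix ι κ ℝ} {R : Matrix κ κ ℝ} {K : Matrix κ ι ℝ} (hR : Rᵀ = R) (hP : Pᵀ = P)
    (hARE : P = Q + Aᵀ * P * (A + B * K)) (hK : (R + Bᵀ * P * B) * K = -(Bᵀ * P * A))
    (z : ι → ℝ) (v : κ → ℝ) :
    wsq Q z + wsq R v + wsq P (A *ᵥ z + B *ᵥ v) =
      wsq P z + wsq (R + Bᵀ * P * B) (v - K *ᵥ z) := by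
  have hsymm {μ : Type} [Fintype μ] {M : Matrix μ μ ℝ} (hM : Mᵀ = M) (a b : μ → ℝ) :
      a ⬝ᵥ (M *ᵥ b) = b ⬝ᵥ (M *ᵥ a) := by
    conv_lhs => rw [← hM, Matrix.dotProduct_transpose_mulVec_eq, dotProduct_comm]
  have hPz : wsq P z = wsq Q z + (A *ᵥ z) ⬝ᵥ (P *ᵥ (A *ᵥ z)) +
      (A *ᵥ z) ⬝ᵥ (P *ᵥ (B *ᵥ (K *ᵥ z))) := by
    conv_lhs => rw [wsq, hARE]
    simp only [wsq, Matrix.add_mulVec, Matrix.mul_add, ← Matrix.mulVec_mulVec, dotProduct_add,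
      Matrix.dotProduct_transpose_mulVec_eq]
    ring
  have hD : (R + Bᵀ * P * B)ᵀ = R + Bᵀ * P * B := by
    simp [Matrix.transpose_mul, hR, hP, Matrix.mul_assoc]
  -- The normal equation `hK`. It is used with `a = v` for the cross term and with `a = K *ᵥ z` to
  -- cancel the last term of `hPz`.
  have hvK (a : κ → ℝ) : a ⬝ᵥ ((R + Bᵀ * P * B) *ᵥ (K *ᵥ z)) =
      -((B *ᵥ a) ⬝ᵥ (P *ᵥ (A *ᵥ z))) := by
    rw [Matrix.mulVec_mulVec, hK]
    simp only [Matrix.neg_mulVec, dotProduct_neg, ← Matrix.mulVec_mulVec,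
      Matrix.dotProduct_transpose_mulVec_eq]
  have hvv : v ⬝ᵥ ((R + Bᵀ * P * B) *ᵥ v) = wsq R v + (B *ᵥ v) ⬝ᵥ (P *ᵥ (B *ᵥ v)) := by
    simp only [wsq, Matrix.add_mulVec, dotProduct_add, ← Matrix.mulVec_mulVec,
      Matrix.dotProduct_transpose_mulVec_eq]
  have hsq : wsq (R + Bᵀ * P * B) (v - K *ᵥ z) = v ⬝ᵥ ((R + Bᵀ * P * B) *ᵥ v) -
      2 * v ⬝ᵥ ((R + Bᵀ * P * B) *ᵥ (K *ᵥ z)) +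
      (K *ᵥ z) ⬝ᵥ ((R + Bᵀ * P * B) *ᵥ (K *ᵥ z)) := by
    rw [wsq, Matrix.mulVec_sub, sub_dotProduct, dotProduct_sub, dotProduct_sub,
      hsymm hD (K *ᵥ z) v]
    ring
  have hnext : wsq P (A *ᵥ z + B *ᵥ v) = (A *ᵥ z) ⬝ᵥ (P *ᵥ (A *ᵥ z)) +
      2 * (B *ᵥ v) ⬝ᵥ (P *ᵥ (A *ᵥ z)) + (B *ᵥ v) ⬝ᵥ (P *ᵥ (B *ᵥ v)) := by
    rw [wsq, Matrix.mulVec_add, add_dotProduct, dotProduct_add, dotProduct_add,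
      hsymm hP (A *ᵥ z) (B *ᵥ v)]
    ring
  rw [hsq, hvK, hvK, hvv, hnext, hPz, hsymm hP (A *ᵥ z) (B *ᵥ (K *ᵥ z))]
  ring

/-- The first-order lower bound of a positive semidefinite quadratic form. -/
theorem Matrix.PosSemidef.wsq_sub_ge {ι : Type} [Fintype ι] {M : Matrix ι ι ℝ}
    (hM : M.PosSemidef) (a b : ι → ℝ) :
    (M *ᵥ a) ⬝ᵥ (b - a) ≤ (1 / 2) * wsq M b - (1 / 2) * wsq M a := by
  have hsymm : b ⬝ᵥ (M *ᵥ a) = a ⬝ᵥ (M *ᵥ b) := by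
    have hMt : Mᵀ = M := by simpa [Matrix.conjTranspose_eq_transpose_of_trivial] using hM.1.eq
    conv_lhs => rw [← hMt, Matrix.dotProduct_transpose_mulVec_eq, dotProduct_comm]
  have h := hM.wsq_nonneg (b - a)
  simp only [wsq, Matrix.mulVec_sub, sub_dotProduct, dotProduct_sub] at h ⊢
  rw [dotProduct_comm _ b, dotProduct_comm _ a]
  linarith

namespace LQGame

variable {N n m : ℕ} {G : LQGame N n m}

theorem BasicAssumption.Q_posSemidef (hG : G.BasicAssumption) (i : Fin N) :
    (G.Q i).PosSemidef := by
  rw [hG.Q_eq i, ← Matrix.conjTranspose_eq_transpose_of_trivial]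
  exact Matrix.posSemidef_conjTranspose_mul_self _

theorem BasicAssumption.stageCost_nonneg (hG : G.BasicAssumption) (i : Fin N) (x : Fin n → ℝ)
    (v : Fin m → ℝ) : 0 ≤ G.stageCost i x v := by
  have h1 := (hG.Q_posSemidef i).wsq_nonneg x
  have h2 := (hG.R_posDef i).posSemidef.wsq_nonneg v
  unfold stageCost
  positivity

/-- `x` is the state sequence of agent `i` under the input `v` when the other agents apply the
gains `K j` to the sequence `y`. -/
def IsResponse (G : LQGame N n m) (K : Fin N → Matrix (Fin m) (Fin n) ℝ) (i : Fin N)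
    (y x : ℕ → Fin n → ℝ) (v : ℕ → Fin m → ℝ) : Prop :=
  ∀ t, x (t + 1) =
    G.A *ᵥ x t + (∑ j ∈ Finset.univ.erase i, G.B j * K j) *ᵥ y t + G.B i *ᵥ v t

theorem V_nonneg {M : Matrix (Fin n ⊕ Fin n) (Fin n ⊕ Fin n) ℝ} (hM : M.PosSemidef)
    (x y : Fin n → ℝ) : 0 ≤ V M x y :=
  mul_nonneg (by norm_num) (hM.wsq_nonneg _)

/-! ### The tail problem of one agent and its cost-to-go. -/

section Augmented

variable {K : Fin N → Matrix (Fin m) (Fin n) ℝ} {i : Fin N}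
  {M : Matrix (Fin n ⊕ Fin n) (Fin n ⊕ Fin n) ℝ}

theorem augmented_step (x y : Fin n → ℝ) (v : Fin m → ℝ) :
    G.Ahat K i *ᵥ Sum.elim x y + G.Bhat i *ᵥ v =
      Sum.elim (G.A *ᵥ x + (∑ j ∈ Finset.univ.erase i, G.B j * K j) *ᵥ y + G.B i *ᵥ v)
        (G.Abar K *ᵥ y) := by
  rw [Ahat, Bhat, Matrix.fromBlocks_mulVec, Matrix.fromRows_mulVec]
  ext (a | a) <;> simp

theorem augmentedWeight_posDef (hG : G.BasicAssumption) (hM : M.PosSemidef) :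
    (G.R i + (G.Bhat i)ᵀ * M * G.Bhat i).PosDef := by
  refine (hG.R_posDef i).add_posSemidef ?_
  rw [← Matrix.conjTranspose_eq_transpose_of_trivial]
  exact hM.conjTranspose_mul_mul_same _

/-- One-step Bellman identity: the square is the loss from not using the feedback `Khat`. -/
theorem stageCost_add_V (hG : G.BasicAssumption) (hM : G.SolvesAugmentedARE K i M)
    (x y : Fin n → ℝ) (v : Fin m → ℝ) :
    G.stageCost i x v +
        V M (G.A *ᵥ x + (∑ j ∈ Finset.univ.erase i, G.B j * K j) *ᵥ y + G.B i *ᵥ v)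
          (G.Abar K *ᵥ y) =
      V M x y + (1 / 2) * wsq (G.R i + (G.Bhat i)ᵀ * M * G.Bhat i)
        (v - G.Khat K i M *ᵥ Sum.elim x y) := by
  have hMt : Mᵀ = M := by
    simpa [Matrix.conjTranspose_eq_transpose_of_trivial] using hM.1.1.eq
  have hRt : (G.R i)ᵀ = G.R i := by
    simpa [Matrix.conjTranspose_eq_transpose_of_trivial] using (hG.R_posDef i).1.eq
  have hdet := (Matrix.isUnit_iff_isUnit_det _).1 (augmentedWeight_posDef (i := i) hG hM.1).isUnit
  have hK : (G.R i + (G.Bhat i)ᵀ * M * G.Bhat i) * G.Khat K i M =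
      -((G.Bhat i)ᵀ * M * G.Ahat K i) := by
    rw [Khat, Matrix.mul_neg, ← Matrix.mul_assoc, ← Matrix.mul_assoc, ← Matrix.mul_assoc,
      Matrix.mul_nonsing_inv _ hdet, Matrix.one_mul]
  have h := wsq_completeSquare hRt hMt hM.2 hK (Sum.elim x y) v
  rw [augmented_step] at h
  have hQ : wsq (G.Qhat i) (Sum.elim x y) = wsq (G.Q i) x := by
    simp [wsq, Qhat, Matrix.fromBlocks_mulVec]
  rw [hQ] at h
  simp only [stageCost, V]
  linarith

/-- The Bellman identity telescopes once its nonnegative squares are dropped. -/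
theorem V_le_sum_stageCost_add_V (hG : G.BasicAssumption) (hM : G.SolvesAugmentedARE K i M)
    {x y : ℕ → Fin n → ℝ} {v : ℕ → Fin m → ℝ} (hx : G.IsResponse K i y x v)
    (hy : ∀ t, y (t + 1) = G.Abar K *ᵥ y t) (S : ℕ) :
    V M (x 0) (y 0) ≤ ∑ t ∈ Finset.range S, G.stageCost i (x t) (v t) + V M (x S) (y S) := by
  induction S with
  | zero => simp
  | succ S ih =>
    have h := stageCost_add_V hG hM (x S) (y S) (v S)
    rw [← hx, ← hy] at h
    have := (augmentedWeight_posDef (i := i) hG hM.1).posSemidef.wsq_nonneg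
      (v S - G.Khat K i M *ᵥ Sum.elim (x S) (y S))
    rw [Finset.sum_range_succ]
    linarith

/-- The feedback `Khat` attains the cost-to-go. -/
theorem exists_response_sum_le_V (hG : G.BasicAssumption) (hM : G.SolvesAugmentedARE K i M)
    {y : ℕ → Fin n → ℝ} (hy : ∀ t, y (t + 1) = G.Abar K *ᵥ y t) (x₀ : Fin n → ℝ) :
    ∃ (x : ℕ → Fin n → ℝ) (v : ℕ → Fin m → ℝ), x 0 = x₀ ∧ G.IsResponse K i y x v ∧
      ∀ S, ∑ t ∈ Finset.range S, G.stageCost i (x t) (v t) ≤ V M x₀ (y 0) := by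
  let x : ℕ → Fin n → ℝ := fun t => Nat.rec x₀ (fun t xt => G.A *ᵥ xt +
    (∑ j ∈ Finset.univ.erase i, G.B j * K j) *ᵥ y t +
    G.B i *ᵥ (G.Khat K i M *ᵥ Sum.elim xt (y t))) t
  let v : ℕ → Fin m → ℝ := fun t => G.Khat K i M *ᵥ Sum.elim (x t) (y t)
  have hx : G.IsResponse K i y x v := fun t => rfl
  refine ⟨x, v, rfl, hx, fun S => ?_⟩
  -- Under the feedback `Khat` the squares vanish, so the Bellman identity telescopes to an
  -- equality.
  have key : ∑ t ∈ Finset.range S, G.stageCost i (x t) (v t) + V M (x S) (y S) =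
      V M x₀ (y 0) := by
    induction S with
    | zero => simp [x]
    | succ S ih =>
      have h := stageCost_add_V hG hM (x S) (y S) (v S)
      rw [← hx, ← hy] at h
      simp only [v, sub_self] at h ⊢
      simp only [v] at ih
      rw [Finset.sum_range_succ, add_assoc, h]
      simpa [wsq] using ih
  linarith [V_nonneg hM.1 (x S) (y S)]

/-- Under detectability, a response of finite cost converges to the origin. -/
theorem IsResponse.tendsto_zero (hG : G.BasicAssumption) (hdet : IsDetectable G.A (G.C i))
    {x y : ℕ → Fin n → ℝ} {v : ℕ → Fin m → ℝ} (hx : G.IsResponse K i y x v)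
    (hy : Tendsto y atTop (𝓝 0)) (hcost : Summable fun t => G.stageCost i (x t) (v t)) :
    Tendsto x atTop (𝓝 0) := by
  obtain ⟨L, hL⟩ := hdet
  have h0 := hcost.tendsto_atTop_zero
  have hQ0 (t) := (hG.Q_posSemidef i).wsq_nonneg (x t)
  have hR0 (t) := (hG.R_posDef i).posSemidef.wsq_nonneg (v t)
  have h2 : Tendsto (fun t => 2 * G.stageCost i (x t) (v t)) atTop (𝓝 0) := by
    simpa using h0.const_mul 2
  have hQ : Tendsto (fun t => wsq (G.Q i) (x t)) atTop (𝓝 0) :=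
    squeeze_zero hQ0 (fun t => by unfold stageCost; linarith [hR0 t]) h2
  have hR : Tendsto (fun t => wsq (G.R i) (v t)) atTop (𝓝 0) :=
    squeeze_zero hR0 (fun t => by unfold stageCost; linarith [hQ0 t]) h2
  have hv : Tendsto v atTop (𝓝 0) := (hG.R_posDef i).tendsto_zero_of_wsq hR
  have hC : Tendsto (fun t => G.C i *ᵥ x t) atTop (𝓝 0) := by
    refine tendsto_zero_of_dotProduct_self ?_
    simpa only [hG.Q_eq i, wsq_transpose_mul_self] using hQ
  have lim {κ ν : ℕ} (F : Matrix (Fin κ) (Fin ν) ℝ) {f : ℕ → Fin ν → ℝ}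
      (hf : Tendsto f atTop (𝓝 0)) : Tendsto (fun t => F *ᵥ f t) atTop (𝓝 0) := by
    have hcont : Continuous fun a : Fin ν → ℝ => F *ᵥ a := by fun_prop
    simpa [Function.comp_def] using (hcont.tendsto 0).comp hf
  -- Output injection: adding and subtracting `L * C i` gives the Schur matrix `A + L * C i` driven
  -- by terms that all vanish.
  refine hL.tendsto_zero (w := fun t => (∑ j ∈ Finset.univ.erase i, G.B j * K j) *ᵥ y t +
    G.B i *ᵥ v t - L *ᵥ (G.C i *ᵥ x t)) (fun t => ?_) ?_
  · rw [hx t, Matrix.add_mulVec, ← Matrix.mulVec_mulVec]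
    abel
  · simpa using ((lim (∑ j ∈ Finset.univ.erase i, G.B j * K j) hy).add (lim (G.B i) hv)).sub
      (lim L hC)

/-- The cost-to-go is a lower bound of the infinite-horizon cost of any response. -/
theorem V_le_tsum_stageCost (hG : G.BasicAssumption) (hM : G.SolvesAugmentedARE K i M)
    (hdet : IsDetectable G.A (G.C i)) {x y : ℕ → Fin n → ℝ} {v : ℕ → Fin m → ℝ}
    (hx : G.IsResponse K i y x v) (hy : ∀ t, y (t + 1) = G.Abar K *ᵥ y t)
    (hy0 : Tendsto y atTop (𝓝 0)) (hcost : Summable fun t => G.stageCost i (x t) (v t)) :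
    V M (x 0) (y 0) ≤ ∑' t, G.stageCost i (x t) (v t) := by
  have hx0 := hx.tendsto_zero hG hdet hy0 hcost
  have hV : Continuous fun q : (Fin n → ℝ) × (Fin n → ℝ) => V M q.1 q.2 := by
    have hs : Continuous fun q : (Fin n → ℝ) × (Fin n → ℝ) => Sum.elim q.1 q.2 := by
      refine continuous_pi fun a => ?_
      rcases a with a | a <;> simp only [Sum.elim_inl, Sum.elim_inr] <;> fun_prop
    unfold V wsq
    fun_prop
  have hlim : Tendsto (fun S => V M (x S) (y S)) atTop (𝓝 0) := by
    have h := (hV.tendsto (0, 0)).comp (hx0.prodMk_nhds hy0)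
    have h0 : V M (0 : Fin n → ℝ) 0 = 0 := by simp [V, wsq]
    simpa [Function.comp_def, h0] using h
  have h := hcost.hasSum.tendsto_sum_nat.add hlim
  rw [add_zero] at h
  exact ge_of_tendsto' h fun S => V_le_sum_stageCost_add_V hG hM hx hy S

/-- The first-order optimality conditions given by the coupled Riccati equations bound the cost of
the unconstrained open-loop input by that of any other response. -/
theorem sum_stageCost_uOL_le (hG : G.BasicAssumption) {P : Fin N → Matrix (Fin n) (Fin n) ℝ}
    (hPK : G.SolvesOLRiccati P K) {x y : ℕ → Fin n → ℝ} {v : ℕ → Fin m → ℝ}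
    (hx : G.IsResponse K i y x v) (hy : ∀ t, y (t + 1) = G.Abar K *ᵥ y t) (hxy : x 0 = y 0)
    (S : ℕ) :
    ∑ t ∈ Finset.range S, G.stageCost i (y t) (K i *ᵥ y t) ≤
      ∑ t ∈ Finset.range S, G.stageCost i (x t) (v t) + (P i *ᵥ y S) ⬝ᵥ (x S - y S) := by
  induction S with
  | zero => simp [hxy]
  | succ S ih =>
    rw [Finset.sum_range_succ, Finset.sum_range_succ]
    have hQ := (hG.Q_posSemidef i).wsq_sub_ge (y S) (x S)
    have hR := (hG.R_posDef i).posSemidef.wsq_sub_ge (K i *ᵥ y S) (v S)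
    have hdet := (Matrix.isUnit_iff_isUnit_det _).1 (hG.R_posDef i).isUnit
    -- With costate `P i *ᵥ y`, this is stationarity in the input, and `hPy` below is the adjoint
    -- equation. Paired with `x - y`, they make the linear terms of the convexity bounds telescope.
    have hRK : G.R i *ᵥ (K i *ᵥ y S) = -((G.B i)ᵀ *ᵥ (P i *ᵥ y (S + 1))) := by
      rw [Matrix.mulVec_mulVec, (hPK i).2, Matrix.mul_neg, Matrix.mul_assoc, Matrix.mul_assoc,
        Matrix.mul_nonsing_inv_cancel_left _ _ hdet, Matrix.neg_mulVec, hy]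
      simp only [Matrix.mulVec_mulVec]
    have hPy : P i *ᵥ y S = G.Q i *ᵥ y S + (G.A)ᵀ *ᵥ (P i *ᵥ y (S + 1)) := by
      conv_lhs => rw [(hPK i).1]
      simp only [Matrix.add_mulVec, hy, Matrix.mulVec_mulVec, Matrix.mul_assoc]
    -- The inputs of the other agents cancel, since both trajectories are driven by the same `y`.
    have hstep : x (S + 1) - y (S + 1) = G.A *ᵥ (x S - y S) + G.B i *ᵥ (v S - K i *ᵥ y S) := by
      rw [hx, hy, Abar, ← Finset.add_sum_erase Finset.univ _ (Finset.mem_univ i)]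
      simp only [Matrix.add_mulVec, Matrix.mulVec_sub, Matrix.mulVec_mulVec]
      abel
    rw [hRK, neg_dotProduct, dotProduct_comm, Matrix.dotProduct_transpose_mulVec_eq] at hR
    rw [hPy, add_dotProduct, dotProduct_comm ((G.A)ᵀ *ᵥ _),
      Matrix.dotProduct_transpose_mulVec_eq] at ih
    rw [hstep, dotProduct_add, dotProduct_comm _ (G.A *ᵥ _), dotProduct_comm _ (G.B i *ᵥ _)]
    simp only [stageCost] at ih ⊢
    linarith

/-- The cost of the unconstrained open-loop input does not exceed the cost-to-go. -/
theorem sum_stageCost_uOL_le_V (hG : G.BasicAssumption)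
    {P : Fin N → Matrix (Fin n) (Fin n) ℝ} (hPK : G.SolvesOLRiccati P K)
    (hM : G.SolvesAugmentedARE K i M) (hdet : IsDetectable G.A (G.C i)) {y : ℕ → Fin n → ℝ}
    (hy : ∀ t, y (t + 1) = G.Abar K *ᵥ y t) (hy0 : Tendsto y atTop (𝓝 0)) (S : ℕ) :
    ∑ t ∈ Finset.range S, G.stageCost i (y t) (K i *ᵥ y t) ≤ V M (y 0) (y 0) := by
  -- The comparison trajectory is the `Khat` response; its finite cost and detectability make the
  -- boundary term `(P i *ᵥ y S) ⬝ᵥ (x S - y S)` vanish in the limit.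
  obtain ⟨x, v, hx0, hx, hle⟩ := exists_response_sum_le_V (i := i) hG hM hy (y 0)
  have hcost : Summable fun t => G.stageCost i (x t) (v t) :=
    summable_of_sum_range_le (fun t => hG.stageCost_nonneg i _ _) hle
  have hxlim := hx.tendsto_zero hG hdet hy0 hcost
  have hlim : Tendsto (fun S => V M (y 0) (y 0) + (P i *ᵥ y S) ⬝ᵥ (x S - y S)) atTop
      (𝓝 (V M (y 0) (y 0))) := by
    have hc : Continuous fun q : (Fin n → ℝ) × (Fin n → ℝ) => (P i *ᵥ q.2) ⬝ᵥ (q.1 - q.2) := by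
      fun_prop
    have h := (hc.tendsto (0, 0)).comp (hxlim.prodMk_nhds hy0)
    simpa [Function.comp_def] using h.const_add (V M (y 0) (y 0))
  refine ge_of_tendsto hlim ?_
  filter_upwards [eventually_ge_atTop S] with S' hS'
  calc ∑ t ∈ Finset.range S, G.stageCost i (y t) (K i *ᵥ y t)
      ≤ ∑ t ∈ Finset.range S', G.stageCost i (y t) (K i *ᵥ y t) :=
        Finset.sum_le_sum_of_subset_of_nonneg (Finset.range_mono hS')
          fun t _ _ => hG.stageCost_nonneg i _ _
    _ ≤ _ := sum_stageCost_uOL_le hG hPK hx hy hx0 S'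
    _ ≤ _ := by linarith [hle S']

end Augmented

/-! ### The extended trajectory and deviations from it. -/

theorem state_congr {x₀ : Fin n → ℝ} {u u' : Fin N → ℕ → Fin m → ℝ} {t : ℕ}
    (h : ∀ j, ∀ s < t, u j s = u' j s) : G.state x₀ u t = G.state x₀ u' t := by
  induction t with
  | zero => rfl
  | succ t ih =>
    simp only [state]
    rw [ih fun j s hs => h j s (hs.trans t.lt_succ_self)]
    simp only [h _ t t.lt_succ_self]

section Extension

variable {T : ℕ} {K : Fin N → Matrix (Fin m) (Fin n) ℝ} {x₀ : Fin n → ℝ}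
  {u : Fin N → Fin T → Fin m → ℝ}

theorem pad_apply_of_lt {w : Fin T → Fin m → ℝ} {t : ℕ} (ht : t < T) : pad w t = w ⟨t, ht⟩ :=
  dif_pos ht

theorem uEX_of_lt {t : ℕ} (ht : t < T) (i : Fin N) : G.uEX K x₀ u i t = pad (u i) t := by
  simp [uEX, pad, ht]

theorem uEX_add (i : Fin N) (k : ℕ) : G.uEX K x₀ u i (T + k) =
    K i *ᵥ ((G.Abar K ^ k) *ᵥ G.state x₀ (fun j => pad (u j)) T) := by
  simp [uEX, uOL]

theorem state_uEX_add (k : ℕ) : G.state x₀ (G.uEX K x₀ u) (T + k) =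
    (G.Abar K ^ k) *ᵥ G.state x₀ (fun j => pad (u j)) T := by
  induction k with
  | zero => simpa using state_congr fun j s hs => uEX_of_lt hs j
  | succ k ih =>
    rw [← add_assoc, state, ih, pow_succ', ← Matrix.mulVec_mulVec]
    simp only [uEX_add]
    generalize (G.Abar K ^ k) *ᵥ G.state x₀ (fun j => pad (u j)) T = z
    simp only [Abar, Matrix.add_mulVec, Matrix.sum_mulVec, Matrix.mulVec_mulVec]

/-- Open-loop information enters here: `y` is the nominal orbit whatever `v` does, before or after
time `T`. -/
theorem isResponse_uEX (i : Fin N) (v : ℕ → Fin m → ℝ) :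
    G.IsResponse K i (fun k => (G.Abar K ^ k) *ᵥ G.state x₀ (fun j => pad (u j)) T)
      (fun k => G.state x₀ (Function.update (G.uEX K x₀ u) i v) (T + k))
      (fun k => v (T + k)) := by
  intro k
  beta_reduce
  rw [← add_assoc, state, ← Finset.add_sum_erase Finset.univ _ (Finset.mem_univ i),
    Function.update_self, add_comm (G.B i *ᵥ _), ← add_assoc, Matrix.sum_mulVec]
  congr 2
  refine Finset.sum_congr rfl fun j hj => ?_
  rw [Function.update_of_ne (Finset.ne_of_mem_erase hj), uEX_add, Matrix.mulVec_mulVec]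

/-- The first `T` entries of a deviation, used as a deviation in the finite-horizon game. -/
theorem state_update_uEX_of_le (i : Fin N) (v : ℕ → Fin m → ℝ) {t : ℕ} (ht : t ≤ T) :
    G.state x₀ (Function.update (G.uEX K x₀ u) i v) t =
      G.state x₀ (Function.update (fun j => pad (u j)) i (pad fun s : Fin T => v s)) t := by
  refine state_congr fun j s hs => ?_
  rcases eq_or_ne j i with rfl | hj
  · simp [pad, hs.trans_le ht]
  · simp only [Function.update_of_ne hj, uEX_of_lt (hs.trans_le ht)]

theorem pad_update (i : Fin N) (w : Fin T → Fin m → ℝ) :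
    (fun j => pad (Function.update u i w j)) = Function.update (fun j => pad (u j)) i (pad w) := by
  ext1 j
  rcases eq_or_ne j i with rfl | hj
  · simp
  · simp [Function.update_of_ne hj]

theorem restrict_mem_feasibleFin {i : Fin N} {v : ℕ → Fin m → ℝ}
    (hv : v ∈ G.feasibleInf x₀ i (G.uEX K x₀ u)) :
    (fun s : Fin T => v s) ∈ G.feasibleFin x₀ i u := by
  refine ⟨fun t ht => ?_, fun t h1 ht => ?_⟩
  · have ht' : t < T := by exact_mod_cast ht
    have h := hv.1 t (ENat.natCast_lt_top t)
    rw [pad_apply_of_lt ht']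
    simpa only [uEX_of_lt ht'] using h
  · have h := hv.2 t h1 le_top
    rwa [state_update_uEX_of_le i v (by exact_mod_cast ht)] at h

/-- The second argument of `V` stays at the nominal terminal state, which is exactly where the orbit
`y` followed by the others starts. -/
theorem costFin_restrict (Phat : Fin N → Matrix (Fin n ⊕ Fin n) (Fin n ⊕ Fin n) ℝ) (i : Fin N)
    (v : ℕ → Fin m → ℝ) :
    G.costFin Phat x₀ i u (fun s : Fin T => v s) =
      ∑ t ∈ Finset.range T,
        G.stageCost i (G.state x₀ (Function.update (G.uEX K x₀ u) i v) t) (v t) +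
      V (Phat i) (G.state x₀ (Function.update (G.uEX K x₀ u) i v) T)
        (G.state x₀ (fun j => pad (u j)) T) := by
  rw [costFin, pad_update, state_update_uEX_of_le i v le_rfl, Finset.sum_range]
  congr 1
  exact Finset.sum_congr rfl fun t _ => by rw [state_update_uEX_of_le i v t.2.le]

theorem uEX_mem_feasibleInf {Xf : Set (Fin n → ℝ)} (hXf : G.IsAdmissibleInvariant K Xf)
    (hterm : G.state x₀ (fun j => pad (u j)) T ∈ Xf) {i : Fin N}
    (hu : u i ∈ G.feasibleFin x₀ i u) :
    G.uEX K x₀ u i ∈ G.feasibleInf x₀ i (G.uEX K x₀ u) := by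
  have hinv (k : ℕ) : (G.Abar K ^ k) *ᵥ G.state x₀ (fun j => pad (u j)) T ∈ Xf := by
    induction k with
    | zero => simpa using hterm
    | succ k ih =>
      rw [pow_succ', ← Matrix.mulVec_mulVec]
      exact hXf.invariant _ ih
  refine ⟨fun t _ => ?_, fun t h1 _ => ?_⟩
  · rcases lt_or_ge t T with ht | ht
    · simp only [uEX_of_lt ht]
      exact hu.1 t (by exact_mod_cast ht)
    · obtain ⟨k, rfl⟩ := Nat.exists_eq_add_of_le ht
      simp only [uEX_add]
      exact hXf.input_mem _ (hinv k) i
  · rw [Function.update_eq_self]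
    rcases lt_or_ge t T with ht | ht
    · have h := hu.2 t h1 (by exact_mod_cast ht.le)
      rw [Function.update_eq_self i (fun j => pad (u j))] at h
      rwa [state_congr fun j s hs => uEX_of_lt (hs.trans ht) j]
    · obtain ⟨k, rfl⟩ := Nat.exists_eq_add_of_le ht
      rw [state_uEX_add]
      exact hXf.subset (hinv k)

end Extension

end LQGame

/-! ### The Nash inequality. -/

theorem mainTheorem1 {N n m T : ℕ} (G : LQGame N n m)
    (hbasic : G.BasicAssumption)
    (hprim : G.PrimitivesAssumption)
    (hstruct : G.StructureAssumption)
    (P : Fin N → Matrix (Fin n) (Fin n) ℝ)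
    (K : Fin N → Matrix (Fin m) (Fin n) ℝ)
    (hPK : G.SolvesOLRiccati P K)
    (hSchur : IsSchur (G.Abar K))
    (Phat : Fin N → Matrix (Fin n ⊕ Fin n) (Fin n ⊕ Fin n) ℝ)
    (hPhat : ∀ i, G.SolvesAugmentedARE K i (Phat i))
    (Xf : Set (Fin n → ℝ))
    (hXf : G.IsAdmissibleInvariant K Xf)
    (x₀ : Fin n → ℝ)
    (hx₀ : x₀ ∈ G.initialSet T Phat Xf)
    (uFH : Fin N → Fin T → (Fin m → ℝ))
    (huFH : G.SolvesFiniteHorizon Phat x₀ uFH)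
    (hterm : G.state x₀ (fun j => LQGame.pad (uFH j)) T ∈ Xf) :
    G.IsOpenLoopNash x₀ (G.uEX K x₀ uFH) := by
  refine ⟨fun i => LQGame.uEX_mem_feasibleInf hXf hterm (huFH i).1, fun i => ?_⟩
  refine le_iInf₂ fun v hv => ?_
  set y : ℕ → Fin n → ℝ :=
    fun k => (G.Abar K ^ k) *ᵥ G.state x₀ (fun j => LQGame.pad (uFH j)) T with hydef
  have hy (t : ℕ) : y (t + 1) = G.Abar K *ᵥ y t := by
    simp only [hydef, pow_succ', Matrix.mulVec_mulVec]
  have hy_lim : Tendsto y atTop (𝓝 0) :=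
    hSchur.tendsto_zero (w := fun _ => 0) (fun t => by rw [hy, add_zero]) tendsto_const_nhds
  have hy_zero : y 0 = G.state x₀ (fun j => LQGame.pad (uFH j)) T := by simp [hydef]
  have hle : G.costInf x₀ i (G.uEX K x₀ uFH) (G.uEX K x₀ uFH i) ≤
      ENNReal.ofReal (G.costFin Phat x₀ i uFH (uFH i)) := by
    have hrestrict : (fun s : Fin T => G.uEX K x₀ uFH i s) = uFH i := by
      ext1 s
      rw [LQGame.uEX_of_lt s.2, LQGame.pad_apply_of_lt s.2]
    have hcost := LQGame.costFin_restrict (K := K) (u := uFH) (x₀ := x₀) (G := G) Phat i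
      (G.uEX K x₀ uFH i)
    rw [hrestrict, Function.update_eq_self] at hcost
    have hT : G.state x₀ (G.uEX K x₀ uFH) T = y 0 := LQGame.state_uEX_add 0
    rw [LQGame.costInf, Function.update_eq_self]
    refine ENNReal.tsum_le_of_sum_range_le fun S => ?_
    rw [← ENNReal.ofReal_sum_of_nonneg fun t _ => hbasic.stageCost_nonneg i _ _]
    refine ENNReal.ofReal_le_ofReal ?_
    -- Enlarging `S` to `T + S` allows splitting at `T` without comparing `S` with `T`.
    refine (Finset.sum_le_sum_of_subset_of_nonneg (Finset.range_mono (Nat.le_add_left S T))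
      fun t _ _ => hbasic.stageCost_nonneg i _ _).trans ?_
    rw [Finset.sum_range_add, hcost, hT, ← hy_zero]
    have htail := LQGame.sum_stageCost_uOL_le_V hbasic hPK (hPhat i) (hprim.detectable i) hy
      hy_lim S
    simpa only [LQGame.state_uEX_add, LQGame.uEX_add] using add_le_add_right htail _
  -- Optimality of `uFH i` is tested against the first `T` entries of `v`; it remains to bound their
  -- finite-horizon cost by the infinite cost of `v`.
  refine hle.trans ((ENNReal.ofReal_le_ofReal
    ((huFH i).2 (LQGame.restrict_mem_feasibleFin hv))).trans ?_)
  rw [LQGame.costFin_restrict (K := K), LQGame.costInf]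
  set x : ℕ → Fin n → ℝ := G.state x₀ (Function.update (G.uEX K x₀ uFH) i v) with hxdef
  -- A deviation of infinite cost is harmless; otherwise the series is summable in `ℝ`, as the
  -- detectability argument requires.
  rcases eq_or_ne (∑' t, ENNReal.ofReal (G.stageCost i (x t) (v t))) ⊤ with htop | htop
  · exact htop ▸ le_top
  have hnn (t : ℕ) := hbasic.stageCost_nonneg i (x t) (v t)
  have hsum : Summable fun t => G.stageCost i (x t) (v t) := by
    simpa only [ENNReal.toReal_ofReal (hnn _)] using ENNReal.summable_toReal htop
  rw [← ENNReal.ofReal_tsum_of_nonneg hnn hsum]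
  refine ENNReal.ofReal_le_ofReal ?_
  rw [← hsum.sum_add_tsum_nat_add T]
  have hshift : Summable fun k => G.stageCost i (x (T + k)) (v (T + k)) := by
    simpa only [add_comm T] using (summable_nat_add_iff T).2 hsum
  have htail := LQGame.V_le_tsum_stageCost hbasic (hPhat i) (hprim.detectable i)
    (LQGame.isResponse_uEX i v) hy hy_lim hshift
  rw [pow_zero, Matrix.one_mulVec] at htail
  simp only [← hxdef, add_comm T, zero_add] at htail
  exact add_le_add_right htail _
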